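/- All graphs are simple and undirected. A graph is \emph{CIS} if every maximal (by inclusion) clique and every maximal stable set of it intersect. It is \emph{vertex-transitive} if for every pair of vertices some automorphism maps one to the other. It is a \emph{Cayley graph} if it is isomorphic to a graph whose vertex set is a group $G$ and in which $g,h$ are adjacent if and only if $g^{-1}h\in S$, for some inverse-closed subset $S\subseteq G$ with $1\notin S$. For $n\ge 3$, let $PX(n)$ be the graph with vertex set $\mathbb{Z}_n\times\mathbb{Z}_2\times\mathbb{Z}_2$ and edge set $\{\{(i,x,y),(i+1,y,z)\} : i\in\mathbb{Z}_n,\ x,y,z\in\mathbb{Z}_2\}$, and let $Q_n$ be the graph obtained from $PX(n)$ by adding all edges $\{(i,x,y),(i,u,v)\}$ with $i\in\mathbb{Z}_n$, $x,y,u,v\in\mathbb{Z}_2$ and $(x,y)\ne(u,v)$. Proposition. Let $n\ge 4$. Then $Q_n$ is a connected vertex-transitive CIS graph of order $4n$ in which every vertex has exactly $7$ neighbors (that is, of valency $7$); its stability number (maximum size of a stable set) is $\alpha(Q_n)=n$ and its clique number is $\omega(Q_n)=4$. Moreover, if $n$ is prime then $Q_n$ is not a Cayley graph. -/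

import Mathlib

namespace CISGraphs

universe u

/-- A graph is CIS if every maximal clique and every maximal stable set intersect. -/
def IsCIS {V : Type u} (G : SimpleGraph V) : Prop :=
  ∀ C S : Set V, Maximal G.IsClique C → Maximal G.IsIndepSet S → (C ∩ S).Nonempty

/-- A graph is vertex-transitive if, for every pair of vertices, some automorphism of the graph
maps one to the other. -/
def IsVertexTransitive {V : Type u} (G : SimpleGraph V) : Prop :=
  ∀ v w : V, ∃ φ : G ≃g G, φ v = w

/-- Every vertex of the graph has exactly `k` neighbors (here `k` is meant to be positive, so that
the junk value `0` of `Set.ncard` on infinite sets plays no role). -/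
def HasValency {V : Type u} (G : SimpleGraph V) (k : ℕ) : Prop :=
  ∀ v : V, (G.neighborSet v).ncard = k

/-- A graph is Cayley if it is isomorphic to the Cayley graph of some group `A` with respect to
some inverse-closed connection set `S` not containing the identity.  An isomorphism makes `A`
equinumerous with the vertex set, so restricting `A` to the universe of `V` loses nothing. -/
def IsCayley {V : Type u} (G : SimpleGraph V) : Prop :=
  ∃ (A : Type u) (_ : Group A) (S : Set A),
    (∀ s ∈ S, s⁻¹ ∈ S) ∧ (1 : A) ∉ S ∧ Nonempty (G ≃g SimpleGraph.mulCayley S)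

/-- For such a connection set, `g` and `h` are adjacent in the Cayley graph
if and only if `g⁻¹ * h ∈ S`. -/
theorem mulCayley_adj_iff {A : Type u} [Group A] {S : Set A} (hS : ∀ s ∈ S, s⁻¹ ∈ S)
    (h1 : (1 : A) ∉ S) (g h : A) : (SimpleGraph.mulCayley S).Adj g h ↔ g⁻¹ * h ∈ S := by
  rw [SimpleGraph.mulCayley_adj']
  constructor
  · rintro ⟨-, s, hs, rfl | rfl⟩
    · simpa using hs
    · simpa using hS s hs
  · intro hs
    refine ⟨?_, _, hs, Or.inl (by simp)⟩
    rintro rfl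
    exact h1 (by simpa using hs)

/-- The Praeger–Xu graph `PX(n)` (for `n ≥ 3`): the vertex set is `ℤ_n × ℤ_2 × ℤ_2` and the edges
are the pairs `{(i, x, y), (i + 1, y, z)}`. -/
def PX (n : ℕ) : SimpleGraph (ZMod n × ZMod 2 × ZMod 2) :=
  SimpleGraph.fromRel fun v w =>
    ∃ (i : ZMod n) (x y z : ZMod 2), v = (i, x, y) ∧ w = (i + 1, y, z)

/-- The graph `Q_n` (for `n ≥ 3`), obtained from `PX(n)` by adding all edges
`{(i, x, y), (i, u, v)}` with `(x, y) ≠ (u, v)`. -/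
def Q (n : ℕ) : SimpleGraph (ZMod n × ZMod 2 × ZMod 2) :=
  PX n ⊔ SimpleGraph.fromRel fun v w =>
    ∃ (i : ZMod n) (p q : ZMod 2 × ZMod 2), p ≠ q ∧ v = (i, p) ∧ w = (i, q)

end CISGraphs

namespace CISGraphs

/-! Read a vertex `(i, x, y)` as labels at positions `i` and `i + 1`; vertices in consecutive fibers
are adjacent when their labels agree at the shared position. Fibers and junctions are cliques of at
most four vertices, and every clique lies in one of them (`isClique_subset`). A stable set has at
most one vertex per fiber, and a maximal one meets every fiber (`exists_mem_fiber`). Its vertices in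
consecutive fibers disagree at the shared position, so they exhaust both labels and every junction
is hit too: this is CIS.

For the Cayley statement, `fst_eq_of_common_not_adj` makes automorphisms permute the fibers, as
rotations or reflections of the cycle. For `n` prime, a regular group of order `4 * n` has a normal
subgroup of order `n`, which acts regularly on the fibers and so contains a rotation `g` by one. The
conjugates of `g` are `g` and `g⁻¹`, so whether `v` is adjacent to its image under `g` cannot depend
on `v`; `exists_adj_and_exists_not_adj` says that it does. -/

theorem natCast_zmod_ne_zero {n k : ℕ} (hk : 0 < k) (hkn : k < n) : (k : ZMod n) ≠ 0 := by
  rw [Ne, ZMod.natCast_eq_zero_iff]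
  exact fun h => absurd (Nat.le_of_dvd hk h) (by omega)

theorem one_ne_zero_zmod {n : ℕ} (hn : 4 ≤ n) : (1 : ZMod n) ≠ 0 := by
  simpa using natCast_zmod_ne_zero (n := n) (k := 1) (by norm_num) (by omega)

theorem two_ne_zero_zmod {n : ℕ} (hn : 4 ≤ n) : (2 : ZMod n) ≠ 0 := by
  simpa using natCast_zmod_ne_zero (n := n) (k := 2) (by norm_num) (by omega)

theorem three_ne_zero_zmod {n : ℕ} (hn : 4 ≤ n) : (3 : ZMod n) ≠ 0 := by
  simpa using natCast_zmod_ne_zero (n := n) (k := 3) (by norm_num) (by omega)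

theorem Q_adj {n : ℕ} (hn : 4 ≤ n) {i j : ZMod n} {x y u v : ZMod 2} :
    (Q n).Adj (i, x, y) (j, u, v) ↔
      (j = i ∧ ¬ (u = x ∧ v = y)) ∨ (j = i + 1 ∧ u = y) ∨ (i = j + 1 ∧ x = v) := by
  have h1 := one_ne_zero_zmod hn
  simp only [Q, PX, SimpleGraph.sup_adj, SimpleGraph.fromRel_adj, Prod.mk.injEq, ne_eq]
  constructor
  · rintro (⟨-, ⟨a, b, c, d, h, h'⟩ | ⟨a, b, c, d, h, h'⟩⟩ |
      ⟨-, ⟨a, ⟨b, c⟩, ⟨d, e⟩, hne, h, h'⟩ | ⟨a, ⟨b, c⟩, ⟨d, e⟩, hne, h, h'⟩⟩)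
    · grind
    · grind
    · simp only [Prod.mk.injEq] at hne h h'
      grind
    · simp only [Prod.mk.injEq] at hne h h'
      grind
  · rintro (⟨rfl, h⟩ | ⟨rfl, rfl⟩ | ⟨rfl, rfl⟩)
    · right
      refine ⟨by grind, Or.inl ⟨j, (x, y), (u, v), ?_, ⟨rfl, rfl⟩, rfl, rfl⟩⟩
      simp only [Prod.mk.injEq]
      grind
    · left
      exact ⟨by simp [h1], Or.inl ⟨i, x, u, v, ⟨rfl, rfl, rfl⟩, rfl, rfl, rfl⟩⟩
    · left
      exact ⟨by simp [h1], Or.inr ⟨j, u, x, y, ⟨rfl, rfl, rfl⟩, rfl, rfl, rfl⟩⟩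

/-! ### Cliques -/

/-- The set of vertices of `Q n` with first coordinate `i`. -/
def fiber (n : ℕ) (i : ZMod n) : Set (ZMod n × ZMod 2 × ZMod 2) := {v | v.1 = i}

/-- The clique of `Q n` of the vertices `(i, x, y)` and `(i + 1, y, z)` for fixed `i` and `y`. -/
def junction (n : ℕ) (i : ZMod n) (y : ZMod 2) : Set (ZMod n × ZMod 2 × ZMod 2) :=
  {v | (v.1 = i ∧ v.2.2 = y) ∨ (v.1 = i + 1 ∧ v.2.1 = y)}

theorem isClique_fiber {n : ℕ} (hn : 4 ≤ n) (i : ZMod n) : (Q n).IsClique (fiber n i) := by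
  rintro ⟨j, x, y⟩ hj ⟨k, u, v⟩ hk hne
  simp only [fiber, Set.mem_ofPred_eq] at hj hk
  simp only [ne_eq, Prod.mk.injEq] at hne
  rw [Q_adj hn]
  grind

theorem isClique_junction {n : ℕ} (hn : 4 ≤ n) (i : ZMod n) (y : ZMod 2) :
    (Q n).IsClique (junction n i y) := by
  rintro ⟨j, a, b⟩ hj ⟨k, c, d⟩ hk hne
  simp only [junction, Set.mem_ofPred_eq] at hj hk
  simp only [ne_eq, Prod.mk.injEq] at hne
  rw [Q_adj hn]
  grind

/-- A vertex joined to both ends of an edge between two fibers lies in the junction of the edge. -/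
theorem mem_junction_of_common_adj {n : ℕ} (hn : 4 ≤ n) {i : ZMod n} {x y z : ZMod 2}
    {s : ZMod n × ZMod 2 × ZMod 2} (h1 : (Q n).Adj (i, x, y) s)
    (h2 : (Q n).Adj (i + 1, y, z) s) : s ∈ junction n i y := by
  obtain ⟨k, a, b⟩ := s
  rw [Q_adj hn] at h1 h2
  have e1 := one_ne_zero_zmod hn
  have e2 := two_ne_zero_zmod hn
  -- Keeps the fibers `i - 1` and `i + 2` apart; this is where `n = 3` would fail.
  have e3 := three_ne_zero_zmod hn
  simp only [junction, Set.mem_ofPred_eq]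
  rcases h1 with ⟨rfl, h⟩ | ⟨rfl, h⟩ | ⟨rfl, h⟩
  · rcases h2 with ⟨h', -⟩ | ⟨h', -⟩ | ⟨-, h'⟩
    · exact absurd (by linear_combination -h') e1
    · exact absurd (by linear_combination -h') e2
    · exact Or.inl ⟨rfl, h'.symm⟩
  · exact Or.inr ⟨rfl, h⟩
  · rcases h2 with ⟨h', -⟩ | ⟨h', -⟩ | ⟨h', -⟩
    · exact absurd (by linear_combination -h') e2
    · exact absurd (by linear_combination -h') e3
    · exact absurd (by linear_combination h') e1

/-- Two vertices adjacent in different fibers are, up to order, of the form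
`(i, x, y)`, `(i + 1, y, z)`. -/
theorem exists_of_adj_of_fst_ne {n : ℕ} (hn : 4 ≤ n) {v w : ZMod n × ZMod 2 × ZMod 2}
    (h : (Q n).Adj v w) (hne : v.1 ≠ w.1) :
    ∃ (i : ZMod n) (x y z : ZMod 2), (v = (i, x, y) ∧ w = (i + 1, y, z)) ∨
      (w = (i, x, y) ∧ v = (i + 1, y, z)) := by
  obtain ⟨i, x, y⟩ := v
  obtain ⟨j, a, b⟩ := w
  rw [Q_adj hn] at h
  rcases h with ⟨rfl, h⟩ | ⟨rfl, rfl⟩ | ⟨rfl, rfl⟩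
  · exact absurd rfl hne
  · exact ⟨i, x, a, b, Or.inl ⟨rfl, rfl⟩⟩
  · exact ⟨j, a, x, y, Or.inr ⟨rfl, rfl⟩⟩

theorem subset_junction_of_isClique {n : ℕ} (hn : 4 ≤ n) {K : Set (ZMod n × ZMod 2 × ZMod 2)}
    (hK : (Q n).IsClique K) {i : ZMod n} {x y z : ZMod 2} (hv : (i, x, y) ∈ K)
    (hw : (i + 1, y, z) ∈ K) : K ⊆ junction n i y := by
  intro s hs
  by_cases h1 : s = (i, x, y)
  · subst h1; exact Or.inl ⟨rfl, rfl⟩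
  by_cases h2 : s = (i + 1, y, z)
  · subst h2; exact Or.inr ⟨rfl, rfl⟩
  exact mem_junction_of_common_adj hn (hK hv hs (Ne.symm h1)) (hK hw hs (Ne.symm h2))

theorem isClique_subset {n : ℕ} (hn : 4 ≤ n) {K : Set (ZMod n × ZMod 2 × ZMod 2)}
    (hK : (Q n).IsClique K) : (∃ i, K ⊆ fiber n i) ∨ ∃ i y, K ⊆ junction n i y := by
  by_cases h : ∃ v ∈ K, ∃ w ∈ K, v.1 ≠ w.1
  · right
    obtain ⟨v, hv, w, hw, hne⟩ := h
    obtain ⟨i, x, y, z, ⟨rfl, rfl⟩ | ⟨rfl, rfl⟩⟩ :=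
      exists_of_adj_of_fst_ne hn (hK hv hw fun h => hne (h ▸ rfl)) hne
    · exact ⟨i, y, subset_junction_of_isClique hn hK hv hw⟩
    · exact ⟨i, y, subset_junction_of_isClique hn hK hw hv⟩
  · left
    push Not at h
    rcases K.eq_empty_or_nonempty with rfl | ⟨v, hv⟩
    · exact ⟨0, Set.empty_subset _⟩
    · exact ⟨v.1, fun w hw => h w hw v hv⟩

theorem fiber_eq_image (n : ℕ) (i : ZMod n) :
    fiber n i = Set.range fun p : ZMod 2 × ZMod 2 => (i, p) := by
  ext ⟨j, p⟩
  simp [fiber, eq_comm]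

theorem ncard_fiber (n : ℕ) (i : ZMod n) : (fiber n i).ncard = 4 := by
  rw [fiber_eq_image, ← Set.image_univ, Set.ncard_image_of_injective _ (Prod.mk_right_injective i),
    Set.ncard_univ]
  simp

theorem ncard_junction_le (n : ℕ) (i : ZMod n) (y : ZMod 2) : (junction n i y).ncard ≤ 4 := by
  have : junction n i y ⊆ (fun p : ZMod 2 × ZMod 2 =>
      if p.1 = 0 then (i, p.2, y) else (i + 1, y, p.2)) '' Set.univ := by
    rintro ⟨j, a, b⟩ (⟨rfl, rfl⟩ | ⟨rfl, rfl⟩)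
    · exact ⟨(0, a), trivial, rfl⟩
    · exact ⟨(1, b), trivial, rfl⟩
  refine (Set.ncard_le_ncard this (Set.toFinite _)).trans ((Set.ncard_image_le).trans ?_)
  rw [Set.ncard_univ]
  simp

theorem ncard_le_of_isClique {n : ℕ} (hn : 4 ≤ n) {K : Set (ZMod n × ZMod 2 × ZMod 2)}
    (hK : (Q n).IsClique K) : K.ncard ≤ 4 := by
  have : NeZero n := ⟨by omega⟩
  rcases isClique_subset hn hK with ⟨i, h⟩ | ⟨i, y, h⟩
  · exact (Set.ncard_le_ncard h (Set.toFinite _)).trans (ncard_fiber n i).le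
  · exact (Set.ncard_le_ncard h (Set.toFinite _)).trans (ncard_junction_le n i y)

theorem cliqueNum_Q {n : ℕ} (hn : 4 ≤ n) : (Q n).cliqueNum = 4 := by
  have : NeZero n := ⟨by omega⟩
  apply le_antisymm
  · obtain ⟨s, hs⟩ := (Q n).exists_isNClique_cliqueNum
    rw [← hs.card_eq, ← Set.ncard_coe_finset]
    exact ncard_le_of_isClique hn hs.isClique
  · rw [← ncard_fiber n 0, Set.ncard_eq_toFinset_card _ (Set.toFinite _)]
    apply SimpleGraph.IsClique.card_le_cliqueNum
    simpa using isClique_fiber hn 0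

/-! ### Stable sets and the CIS property -/

theorem fst_injOn_of_isIndepSet {n : ℕ} (hn : 4 ≤ n) {S : Set (ZMod n × ZMod 2 × ZMod 2)}
    (hS : (Q n).IsIndepSet S) : Set.InjOn Prod.fst S := by
  intro v hv w hw h
  by_contra hne
  exact hS hv hw hne (isClique_fiber hn w.1 h rfl hne)

theorem indepNum_Q {n : ℕ} (hn : 4 ≤ n) : (Q n).indepNum = n := by
  have : NeZero n := ⟨by omega⟩
  apply le_antisymm
  · obtain ⟨s, hs⟩ := (Q n).exists_isNIndepSet_indepNum
    rw [← hs.card_eq]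
    simpa using Finset.card_le_card_of_injOn (t := (Finset.univ : Finset (ZMod n))) Prod.fst
      (fun _ _ => Finset.mem_univ _) (fst_injOn_of_isIndepSet hn hs.isIndepSet)
  · let s : Finset (ZMod n × ZMod 2 × ZMod 2) :=
      Finset.univ.image fun i : ZMod n => (i, (0 : ZMod 2), (1 : ZMod 2))
    have hs : (Q n).IsIndepSet (s : Set (ZMod n × ZMod 2 × ZMod 2)) := by
      intro v hv w hw hne
      simp only [s, Finset.coe_image, Finset.coe_univ, Set.image_univ, Set.mem_range] at hv hw
      obtain ⟨i, rfl⟩ := hv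
      obtain ⟨j, rfl⟩ := hw
      rw [Q_adj hn]
      simp
    have hc : s.card = n := by
      rw [Finset.card_image_of_injective _ fun i j h => (Prod.mk.inj h).1]
      simp
    exact hc.symm.le.trans hs.card_le_indepNum

/-- A maximal stable set meets every fiber. -/
theorem exists_mem_fiber {n : ℕ} (hn : 4 ≤ n) {S : Set (ZMod n × ZMod 2 × ZMod 2)}
    (hS : Maximal (Q n).IsIndepSet S) (i : ZMod n) : ∃ x y, (i, x, y) ∈ S := by
  by_contra! h
  -- At most one vertex of `S` lies in fiber `i - 1`, so one of the two labels is free; likewise on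
  -- the other side. The free labels give a vertex that could be added to `S`.
  have hx : ∃ x, ∀ a b, (i - 1, a, b) ∈ S → b ≠ x := by
    by_cases h' : ∃ a b, (i - 1, a, b) ∈ S
    · obtain ⟨a, b, hab⟩ := h'
      refine ⟨b + 1, fun c d hcd => ?_⟩
      have := fst_injOn_of_isIndepSet hn hS.prop hab hcd rfl
      simp only [Prod.mk.injEq] at this
      simp [← this.2.2]
    · push Not at h'
      exact ⟨0, fun a b hab => absurd hab (h' a b)⟩
  have hy : ∃ y, ∀ a b, (i + 1, a, b) ∈ S → a ≠ y := by
    by_cases h' : ∃ a b, (i + 1, a, b) ∈ S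
    · obtain ⟨a, b, hab⟩ := h'
      refine ⟨a + 1, fun c d hcd => ?_⟩
      have := fst_injOn_of_isIndepSet hn hS.prop hab hcd rfl
      simp only [Prod.mk.injEq] at this
      simp [← this.2.1]
    · push Not at h'
      exact ⟨0, fun a b hab => absurd hab (h' a b)⟩
  obtain ⟨x, hx⟩ := hx
  obtain ⟨y, hy⟩ := hy
  have hnon : ∀ w ∈ S, ¬ (Q n).Adj (i, x, y) w := by
    rintro ⟨j, a, b⟩ hw hadj
    rw [Q_adj hn] at hadj
    rcases hadj with ⟨rfl, -⟩ | ⟨rfl, rfl⟩ | ⟨rfl, rfl⟩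
    · exact h _ _ hw
    · exact hy _ _ hw rfl
    · exact hx a x (by simpa using hw) rfl
  have hind : (Q n).IsIndepSet (insert (i, x, y) S) := by
    rintro v (rfl | hv) w (rfl | hw) hne
    · exact absurd rfl hne
    · exact hnon w hw
    · exact fun h' => hnon v hv h'.symm
    · exact hS.prop hv hw hne
  exact h x y (hS.le_of_ge hind (Set.subset_insert _ _) (Set.mem_insert _ _))

theorem isCIS_Q {n : ℕ} (hn : 4 ≤ n) : IsCIS (Q n) := by
  intro C S hC hS
  rcases isClique_subset hn hC.prop with ⟨i, h⟩ | ⟨i, y, h⟩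
  · obtain ⟨x, y, hxy⟩ := exists_mem_fiber hn hS i
    exact ⟨_, hC.le_of_ge (isClique_fiber hn i) h rfl, hxy⟩
  · obtain ⟨a, b, hab⟩ := exists_mem_fiber hn hS i
    obtain ⟨c, d, hcd⟩ := exists_mem_fiber hn hS (i + 1)
    have hbc : b ≠ c := by
      rintro rfl
      have h1 := one_ne_zero_zmod hn
      refine hS.prop hab hcd (by simp [h1]) ?_
      rw [Q_adj hn]
      simp
    have key : ∀ b c y : ZMod 2, b ≠ c → b = y ∨ c = y := by decide
    rcases key b c y hbc with rfl | rfl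
    · exact ⟨_, hC.le_of_ge (isClique_junction hn i b) h (Or.inl ⟨rfl, rfl⟩), hab⟩
    · exact ⟨_, hC.le_of_ge (isClique_junction hn i c) h (Or.inr ⟨rfl, rfl⟩), hcd⟩

/-! ### Connectedness, valency and vertex-transitivity -/

theorem connected_Q {n : ℕ} (hn : 4 ≤ n) : (Q n).Connected := by
  have : NeZero n := ⟨by omega⟩
  have hfib : ∀ i x y, (Q n).Reachable (i, 0, 0) (i, x, y) := by
    intro i x y
    by_cases h : ((i, 0, 0) : ZMod n × ZMod 2 × ZMod 2) = (i, x, y)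
    · rw [h]
    · exact (isClique_fiber hn i rfl rfl h).reachable
  have hnat : ∀ k : ℕ, (Q n).Reachable (0, 0, 0) ((k : ZMod n), 0, 0) := by
    intro k
    induction k with
    | zero => simp
    | succ k ih =>
      refine ih.trans (SimpleGraph.Adj.reachable ?_)
      rw [Q_adj hn]
      simp
  have hall : ∀ v, (Q n).Reachable (0, 0, 0) v := by
    rintro ⟨i, x, y⟩
    have := (hnat i.val).trans (hfib _ x y)
    rwa [ZMod.natCast_zmod_val] at this
  exact ⟨fun v w => (hall v).symm.trans (hall w)⟩

theorem hasValency_Q {n : ℕ} (hn : 4 ≤ n) : HasValency (Q n) 7 := by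
  have : NeZero n := ⟨by omega⟩
  have e1 := one_ne_zero_zmod hn
  have e2 := two_ne_zero_zmod hn
  rintro ⟨i, x, y⟩
  have h : (Q n).neighborSet (i, x, y) = (({(i, x, y + 1), (i, x + 1, y), (i, x + 1, y + 1),
      (i + 1, y, 0), (i + 1, y, 1), (i - 1, 0, x), (i - 1, 1, x)} :
        Finset (ZMod n × ZMod 2 × ZMod 2)) : Set _) := by
    ext ⟨j, a, b⟩
    simp only [SimpleGraph.mem_neighborSet, Finset.coe_insert, Finset.coe_singleton,
      Set.mem_insert_iff, Set.mem_singleton_iff, Prod.mk.injEq]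
    have side : ∀ a b x y : ZMod 2, (¬ (a = x ∧ b = y) ↔ (a = x ∧ b = y + 1) ∨
      (a = x + 1 ∧ b = y) ∨ (a = x + 1 ∧ b = y + 1)) := by decide
    have next : ∀ a b y : ZMod 2, a = y ↔ (a = y ∧ b = 0) ∨ (a = y ∧ b = 1) := by decide
    have prev : ∀ a b x : ZMod 2, x = b ↔ (a = 0 ∧ b = x) ∨ (a = 1 ∧ b = x) := by decide
    conv_lhs =>
      rw [Q_adj hn, ← sub_eq_iff_eq_add (a := i), eq_comm (a := i - 1), side, next a b y,
        prev a b x]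
    simp only [and_or_left, or_assoc]
  have h3 : i - 1 ≠ i + 1 := fun h => e2 (by linear_combination -h)
  have h4 : i ≠ i - 1 := fun h => e1 (by linear_combination h)
  rw [h, Set.ncard_coe_finset]
  repeat rw [Finset.card_insert_of_notMem]
  all_goals simp [e1, h3.symm, h4]

/-- The automorphism of `Q n` that rotates the fibers by `k` and exchanges the two labels at the
positions where `f` is nonzero. -/
def rotateFlip {n : ℕ} (hn : 4 ≤ n) (k : ZMod n) (f : ZMod n → ZMod 2) : Q n ≃g Q n where
  toFun v := (v.1 + k, v.2.1 + f v.1, v.2.2 + f (v.1 + 1))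
  invFun v := (v.1 - k, v.2.1 - f (v.1 - k), v.2.2 - f (v.1 - k + 1))
  left_inv := by rintro ⟨i, x, y⟩; simp
  right_inv := by rintro ⟨i, x, y⟩; simp
  map_rel_iff' := by
    rintro ⟨i, x, y⟩ ⟨j, a, b⟩
    simp only [Equiv.coe_fn_mk]
    rw [Q_adj hn, Q_adj hn]
    have h1 : j + k = i + k + 1 ↔ j = i + 1 := by
      rw [add_right_comm]; exact add_left_inj k
    have h2 : i + k = j + k + 1 ↔ i = j + 1 := by
      rw [add_right_comm]; exact add_left_inj k
    rw [h1, h2, add_left_inj]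
    refine or_congr (and_congr_right ?_) (or_congr (and_congr_right ?_) (and_congr_right ?_))
    · rintro rfl; simp
    · rintro rfl; simp
    · rintro rfl; simp

theorem isVertexTransitive_Q {n : ℕ} (hn : 4 ≤ n) : IsVertexTransitive (Q n) := by
  have e1 := one_ne_zero_zmod hn
  rintro ⟨i, x, y⟩ ⟨j, a, b⟩
  -- Only positions `i` and `i + 1` matter, and they are distinct.
  refine ⟨rotateFlip hn (j - i) (fun t => if t = i then a - x else b - y), ?_⟩
  simp [rotateFlip, e1]

/-! ### Action of automorphisms on the fibers -/

/-- An edge with two distinct nonadjacent common neighbors lies inside a fiber. -/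
theorem fst_eq_of_common_not_adj {n : ℕ} (hn : 4 ≤ n) {v w s t : ZMod n × ZMod 2 × ZMod 2}
    (h : (Q n).Adj v w) (hvs : (Q n).Adj v s) (hws : (Q n).Adj w s) (hvt : (Q n).Adj v t)
    (hwt : (Q n).Adj w t) (hst : s ≠ t) (hnst : ¬ (Q n).Adj s t) : v.1 = w.1 := by
  by_contra hne
  obtain ⟨i, x, y, z, ⟨rfl, rfl⟩ | ⟨rfl, rfl⟩⟩ := exists_of_adj_of_fst_ne hn h hne
  · exact hnst (isClique_junction hn i y (mem_junction_of_common_adj hn hvs hws)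
      (mem_junction_of_common_adj hn hvt hwt) hst)
  · exact hnst (isClique_junction hn i y (mem_junction_of_common_adj hn hws hvs)
      (mem_junction_of_common_adj hn hwt hvt) hst)

/-- The two endpoints share a neighbor in their own fiber and one in fiber `i - 1` that are not
adjacent, and automorphisms preserve this pattern. -/
theorem fst_map_eq_of_left_eq {n : ℕ} (hn : 4 ≤ n) (φ : Q n ≃g Q n) (i : ZMod n)
    (x y y' : ZMod 2) : (φ (i, x, y)).1 = (φ (i, x, y')).1 := by
  by_cases hy : y = y'
  · rw [hy]
  have e1 := one_ne_zero_zmod hn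
  have h : ∀ {v w}, (Q n).Adj v w → (Q n).Adj (φ v) (φ w) := fun h => φ.map_adj_iff.2 h
  refine fst_eq_of_common_not_adj hn (s := φ (i, x + 1, y)) (t := φ (i - 1, 0, x))
    (h ?_) (h ?_) (h ?_) (h ?_) (h ?_) (fun h' => ?_) (fun h' => ?_)
  iterate 5
    rw [Q_adj hn]
    simp [Ne.symm hy]
  · have h2 : i ≠ i - 1 := fun h => e1 (by linear_combination h)
    simpa [h2] using φ.injective h'
  · rw [φ.map_adj_iff, Q_adj hn] at h'
    have h2 : i - 1 ≠ i + 1 := fun h => two_ne_zero_zmod hn (by linear_combination -h)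
    simp [e1, h2] at h'

theorem fst_map_eq_of_right_eq {n : ℕ} (hn : 4 ≤ n) (φ : Q n ≃g Q n) (i : ZMod n)
    (x x' y : ZMod 2) : (φ (i, x, y)).1 = (φ (i, x', y)).1 := by
  by_cases hx : x = x'
  · rw [hx]
  have e1 := one_ne_zero_zmod hn
  have h : ∀ {v w}, (Q n).Adj v w → (Q n).Adj (φ v) (φ w) := fun h => φ.map_adj_iff.2 h
  refine fst_eq_of_common_not_adj hn (s := φ (i, x, y + 1)) (t := φ (i + 1, y, 0))
    (h ?_) (h ?_) (h ?_) (h ?_) (h ?_) (fun h' => ?_) (fun h' => ?_)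
  iterate 5
    rw [Q_adj hn]
    simp [Ne.symm hx, hx]
  · have := φ.injective h'
    simp [e1] at this
  · rw [φ.map_adj_iff, Q_adj hn] at h'
    have h2 : i ≠ i + 1 + 1 := fun h => two_ne_zero_zmod hn (by linear_combination -h)
    simp [e1, h2] at h'

/-- Automorphisms of `Q n` permute the fibers. -/
theorem fst_map_eq {n : ℕ} (hn : 4 ≤ n) (φ : Q n ≃g Q n) (v : ZMod n × ZMod 2 × ZMod 2) :
    (φ v).1 = (φ (v.1, 0, 0)).1 := by
  obtain ⟨i, x, y⟩ := v
  -- Labels change one at a time: an edge changing both has only two common neighbors, and these are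
  -- adjacent.
  exact (fst_map_eq_of_left_eq hn φ i x y 0).trans (fst_map_eq_of_right_eq hn φ i x 0 0)

theorem fst_map_eq_iff {n : ℕ} (hn : 4 ≤ n) (φ : Q n ≃g Q n)
    {v w : ZMod n × ZMod 2 × ZMod 2} : (φ v).1 = (φ w).1 ↔ v.1 = w.1 := by
  have key : ∀ (φ : Q n ≃g Q n) {v w : ZMod n × ZMod 2 × ZMod 2},
      v.1 = w.1 → (φ v).1 = (φ w).1 := fun φ v w h => by
    rw [fst_map_eq hn φ v, fst_map_eq hn φ w, h]
  exact ⟨fun h => by simpa using key φ.symm h, key φ⟩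

/-- An automorphism of `Q n` maps consecutive fibers to consecutive fibers. -/
theorem fst_map_add_one {n : ℕ} (hn : 4 ≤ n) (φ : Q n ≃g Q n) (i : ZMod n) :
    (φ (i + 1, 0, 0)).1 = (φ (i, 0, 0)).1 + 1 ∨ (φ (i + 1, 0, 0)).1 = (φ (i, 0, 0)).1 - 1 := by
  have e1 := one_ne_zero_zmod hn
  have h : (Q n).Adj (φ (i, 0, 0)) (φ (i + 1, 0, 0)) := by
    rw [φ.map_adj_iff, Q_adj hn]
    simp
  have hne : (φ (i, 0, 0)).1 ≠ (φ (i + 1, 0, 0)).1 := by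
    rw [Ne, fst_map_eq_iff hn]
    simp [e1]
  obtain ⟨j, x, y, z, ⟨h1, h2⟩ | ⟨h1, h2⟩⟩ := exists_of_adj_of_fst_ne hn h hne <;>
    simp [h1, h2]

/-- An automorphism of `Q n` acts on the fibers as a rotation or as a reflection. -/
theorem fst_map_rotation_or_reflection {n : ℕ} (hn : 4 ≤ n) (φ : Q n ≃g Q n) :
    (∃ c, ∀ v, (φ v).1 = c + v.1) ∨ ∃ c, ∀ v, (φ v).1 = c - v.1 := by
  have : NeZero n := ⟨by omega⟩
  have h2 := two_ne_zero_zmod hn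
  set π : ZMod n → ZMod n := fun i => (φ (i, 0, 0)).1 with hπ
  have hstep : ∀ i, π (i + 1) = π i + 1 ∨ π (i + 1) = π i - 1 := fst_map_add_one hn φ
  -- No backtracking, so the direction of the first step persists.
  have hinj : ∀ i, π (i + 1 + 1) ≠ π i := fun i h => by
    rw [hπ, fst_map_eq_iff hn] at h
    exact h2 (by linear_combination h)
  have hnat : ∀ d : ZMod n, π 1 = π 0 + d → (d = 1 ∨ d = -1) →
      ∀ k : ℕ, π (k + 1) = π k + d := by
    intro d h0 hd k
    induction k with
    | zero => simpa using h0
    | succ k ih =>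
      push_cast
      have h3 := hinj k
      rcases hd with rfl | rfl <;> rcases hstep (k + 1) with h | h <;> grind
  have hlin : ∀ d : ZMod n, (∀ k : ℕ, π (k + 1) = π k + d) → ∀ i, π i = π 0 + i * d := by
    intro d hd i
    have : ∀ k : ℕ, π k = π 0 + k * d := by
      intro k
      induction k with
      | zero => simp
      | succ k ih => push_cast; rw [hd, ih]; ring
    simpa using this i.val
  rcases hstep 0 with h | h
  · left
    refine ⟨π 0, fun v => ?_⟩
    rw [fst_map_eq hn φ v]
    simpa using hlin 1 (hnat 1 (by simpa using h) (Or.inl rfl)) v.1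
  · right
    refine ⟨π 0, fun v => ?_⟩
    rw [fst_map_eq hn φ v]
    simpa [sub_eq_add_neg] using
      hlin (-1) (hnat (-1) (by simpa [sub_eq_add_neg] using h) (Or.inr rfl)) v.1

/-- An automorphism moving every fiber to the next one maps some vertex to a neighbor and some
vertex to a non-neighbor. -/
theorem exists_adj_and_exists_not_adj {n : ℕ} (hn : 4 ≤ n) (φ : Q n ≃g Q n)
    (hφ : ∀ v, (φ v).1 = v.1 + 1) :
    (∃ v, (Q n).Adj v (φ v)) ∧ ∃ v, ¬ (Q n).Adj v (φ v) := by
  have e1 := one_ne_zero_zmod hn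
  have h2 : (0 : ZMod n) ≠ 1 + 1 := fun h => two_ne_zero_zmod hn (by linear_combination -h)
  -- This vertex is adjacent to every `(0, 0, y)`, so all their images have the same first label
  -- `c`; then `y = c` gives a neighbor and `y = c + 1` a non-neighbor.
  obtain ⟨⟨j, a, c⟩, hw⟩ : ∃ w, φ (-1, 0, 0) = w := ⟨_, rfl⟩
  have hj : j = 0 := by simpa [hw] using hφ (-1, 0, 0)
  subst hj
  have key : ∀ y, ∃ b, φ (0, 0, y) = (0 + 1, c, b) := by
    intro y
    obtain ⟨⟨k, d, b⟩, hv⟩ : ∃ w, φ (0, 0, y) = w := ⟨_, rfl⟩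
    have hk : k = 0 + 1 := by simpa [hv] using hφ (0, 0, y)
    have hadj : (Q n).Adj (φ (-1, 0, 0)) (φ (0, 0, y)) := by
      rw [φ.map_adj_iff, Q_adj hn]
      simp
    subst hk
    rw [hw, hv, Q_adj hn] at hadj
    have hd : d = c := by simpa [e1, h2] using hadj
    exact ⟨b, by rw [hv, hd]⟩
  constructor
  · obtain ⟨b, hb⟩ := key c
    exact ⟨(0, 0, c), by rw [hb, Q_adj hn]; simp⟩
  · obtain ⟨b, hb⟩ := key (c + 1)
    refine ⟨(0, 0, c + 1), ?_⟩
    rw [hb, Q_adj hn]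
    simp [e1, h2]

/-! ### Left translations and the Cayley obstruction -/

/-- The automorphism of a graph isomorphic to a Cayley graph given by a left translation. -/
def leftTranslation {V A : Type*} [Group A] {S : Set A} {G : SimpleGraph V}
    (hS : ∀ s ∈ S, s⁻¹ ∈ S) (h1 : (1 : A) ∉ S) (e : G ≃g SimpleGraph.mulCayley S) (a : A) :
    G ≃g G where
  toEquiv := e.toEquiv.trans ((Equiv.mulLeft a).trans e.toEquiv.symm)
  map_rel_iff' := by
    intro v w
    rw [← e.map_adj_iff, ← e.map_adj_iff]
    simp only [Equiv.trans_apply, Equiv.coe_mulLeft]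
    change (SimpleGraph.mulCayley S).Adj (e (e.symm (a * e v))) (e (e.symm (a * e w))) ↔ _
    simp only [RelIso.apply_symm_apply]
    rw [mulCayley_adj_iff hS h1, mulCayley_adj_iff hS h1]
    simp [mul_assoc]

section leftTranslation

variable {V A : Type*} [Group A] {S : Set A} {G : SimpleGraph V}
    (hS : ∀ s ∈ S, s⁻¹ ∈ S) (h1 : (1 : A) ∉ S) (e : G ≃g SimpleGraph.mulCayley S)

theorem leftTranslation_apply (a : A) (v : V) :
    leftTranslation hS h1 e a v = e.symm (a * e v) := rfl

theorem leftTranslation_mul (a b : A) (v : V) :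
    leftTranslation hS h1 e (a * b) v =
      leftTranslation hS h1 e a (leftTranslation hS h1 e b v) := by
  simp [leftTranslation_apply, mul_assoc]

theorem leftTranslation_one (v : V) : leftTranslation hS h1 e 1 v = v := by
  simp [leftTranslation_apply]

theorem leftTranslation_inv_cancel (a : A) (v : V) :
    leftTranslation hS h1 e a⁻¹ (leftTranslation hS h1 e a v) = v := by
  rw [← leftTranslation_mul, inv_mul_cancel, leftTranslation_one]

theorem leftTranslation_injective (v : V) :
    Function.Injective fun a => leftTranslation hS h1 e a v := by
  intro a b h
  simpa [leftTranslation_apply] using h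

theorem adj_leftTranslation_iff (a : A) (v : V) :
    G.Adj v (leftTranslation hS h1 e a v) ↔ (e v)⁻¹ * a * e v ∈ S := by
  rw [← e.map_adj_iff, leftTranslation_apply, RelIso.apply_symm_apply, mulCayley_adj_iff hS h1,
    mul_assoc]

end leftTranslation

/-- A group of order `4 * p` with `p ≥ 5` prime has a normal subgroup of order `p`. -/
theorem exists_normal_subgroup_card_prime {A : Type*} [Group A] {p : ℕ} (hp : p.Prime)
    (h5 : 5 ≤ p) (hA : Nat.card A = 4 * p) : ∃ P : Subgroup A, P.Normal ∧ Nat.card P = p := by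
  have : Fact p.Prime := ⟨hp⟩
  have : Finite A := Nat.finite_of_card_ne_zero (by omega)
  obtain ⟨P⟩ : Nonempty (Sylow p A) := inferInstance
  have h4 : Nat.factorization 4 p = 0 :=
    Nat.factorization_eq_zero_of_lt (by omega)
  have hcard : Nat.card P = p := by
    rw [P.card_eq_multiplicity, hA, Nat.factorization_mul (by norm_num) hp.ne_zero]
    simp [h4, hp.factorization_self]
  have hidx : P.index = 4 := by
    have := P.card_mul_index
    rw [hA] at this
    have h' : Nat.card (P : Subgroup A) = p := hcard
    rw [h', mul_comm] at this
    exact Nat.eq_of_mul_eq_mul_right hp.pos this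
  have hdvd := P.card_dvd_index
  rw [hidx] at hdvd
  have hle := Nat.le_of_dvd (by norm_num) hdvd
  -- The number of Sylow subgroups is at most `4 < p`, so the congruence forces it to be one.
  have hmod : Nat.card (Sylow p A) % p = 1 % p := card_sylow_modEq_one p A
  rw [Nat.mod_eq_of_lt (by omega), Nat.mod_eq_of_lt (by omega)] at hmod
  have : Subsingleton (Sylow p A) := (Nat.card_eq_one_iff_unique.1 hmod).1
  exact ⟨P, P.normal_of_subsingleton, hcard⟩

theorem not_isCayley_Q {n : ℕ} (hn : 4 ≤ n) (hp : n.Prime) : ¬ IsCayley (Q n) := by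
  have hne : NeZero n := ⟨by omega⟩
  have : Fact n.Prime := ⟨hp⟩
  have h5 : 5 ≤ n := by
    rcases hn.eq_or_lt with rfl | h
    · norm_num at hp
    · exact h
  rintro ⟨A, _, S, hS, h1, ⟨e⟩⟩
  have hA : Nat.card A = 4 * n := by
    rw [← Nat.card_congr e.toEquiv]
    simp [Nat.card_eq_fintype_card, ZMod.card, mul_comm]
  obtain ⟨P, hPn, hPc⟩ := exists_normal_subgroup_card_prime hp h5 hA
  have : Finite A := Nat.finite_of_card_ne_zero (by omega)
  set φ := leftTranslation hS h1 e with hφ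
  have hmul : ∀ a b v, φ (a * b) v = φ a (φ b v) := leftTranslation_mul hS h1 e
  have hone : ∀ v, φ 1 v = v := leftTranslation_one hS h1 e
  have hinv : ∀ a v, φ a⁻¹ (φ a v) = v := leftTranslation_inv_cancel hS h1 e
  let o : ZMod n × ZMod 2 × ZMod 2 := (0, 0, 0)
  -- the only element of `P` that fixes a fiber is the identity
  have hstab : ∀ q ∈ P, (φ q o).1 = 0 → q = 1 := by
    intro q hq h
    by_contra hq1
    let B : Subgroup A :=
      { carrier := {a | (φ a o).1 = o.1}
        one_mem' := by simp [hone]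
        mul_mem' := fun {a b} ha hb => by
          simp only [Set.mem_ofPred_eq] at ha hb ⊢
          rw [hmul, ← ha, fst_map_eq_iff hn, hb]
        inv_mem' := fun {a} ha => by
          simp only [Set.mem_ofPred_eq] at ha ⊢
          rw [← fst_map_eq_iff hn (φ a), ← hmul, mul_inv_cancel, hone, ha] }
    -- Since `q` generates `P`, all of `P` keeps `o` in its fiber; the action is free, so `n ≤ 4`.
    have hPB : P ≤ B := by
      have hz : Subgroup.zpowers q = P := by
        apply Subgroup.eq_of_le_of_card_ge ((Subgroup.zpowers_le).2 hq)
        rw [hPc, Nat.card_zpowers]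
        have hd : orderOf q ∣ n := by
          rw [← hPc]
          exact Subgroup.orderOf_dvd_natCard P hq
        rcases (Nat.dvd_prime hp).1 hd with h | h
        · exact absurd (orderOf_eq_one_iff.1 h) hq1
        · exact h.ge
      rw [← hz]
      exact (Subgroup.zpowers_le).2 h
    have hle : (P : Set A).ncard ≤ (fiber n 0).ncard :=
      Set.ncard_le_ncard_of_injOn (fun a => φ a o) (fun a ha => hPB ha)
        (leftTranslation_injective hS h1 e o).injOn (Set.toFinite _)
    rw [ncard_fiber] at hle
    have : (P : Set A).ncard = n := hPc
    omega
  have hinjP : ∀ a ∈ P, ∀ b ∈ P, (φ a o).1 = (φ b o).1 → a = b := by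
    intro a ha b hb h
    have := hstab (a⁻¹ * b) (P.mul_mem (P.inv_mem ha) hb) (by
      rw [hmul]
      have h' := (fst_map_eq_iff hn (φ a⁻¹)).2 h
      rw [hinv] at h'
      exact h'.symm)
    exact (inv_mul_eq_one.1 this)
  obtain ⟨⟨g, hgP⟩, hg⟩ : ∃ g : P, (φ g o).1 = 1 := by
    have hi : Function.Injective fun g : P => (φ g o).1 :=
      fun a b h => Subtype.ext (hinjP a a.2 b b.2 h)
    have hb := hi.bijective_of_nat_card_le (by rw [hPc, Nat.card_zmod])
    exact hb.surjective 1
  simp only at hg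
  have hg1 : g ≠ 1 := by
    rintro rfl
    rw [hone] at hg
    exact one_ne_zero_zmod hn hg.symm
  have hrot : ∀ v, (φ g v).1 = v.1 + 1 := by
    rcases fst_map_rotation_or_reflection hn (φ g) with ⟨c, hc⟩ | ⟨c, hc⟩
    · have : c = 1 := by simpa [hc, o] using hg
      intro v
      rw [hc, this, add_comm]
    · exfalso
      -- A reflection squares to the identity on fibers, but `P` has odd order.
      have h2 : g * g = 1 := by
        apply hstab _ (P.mul_mem hgP hgP)
        rw [hmul, hc, hc]
        simp [o]
      have hd : orderOf g ∣ 2 := orderOf_dvd_of_pow_eq_one (by rw [pow_two, h2])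
      have hd' : orderOf g ∣ n := by
        rw [← hPc]
        exact Subgroup.orderOf_dvd_natCard P hgP
      rcases (Nat.dvd_prime hp).1 hd' with h | h
      · exact hg1 (orderOf_eq_one_iff.1 h)
      · rw [h] at hd
        have := Nat.le_of_dvd (by norm_num) hd
        omega
  have hrotinv : ∀ v, (φ g⁻¹ v).1 = v.1 - 1 := by
    intro v
    have := hrot (φ g⁻¹ v)
    rw [← hmul, mul_inv_cancel, hone] at this
    rw [this]
    ring
  -- On fibers, rotations commute with `g` and reflections invert it; `hinjP` lifts this to an
  -- equality in `P`.
  have hconj : ∀ a : A, a⁻¹ * g * a = g ∨ a⁻¹ * g * a = g⁻¹ := by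
    intro a
    have hq : a⁻¹ * g * a ∈ P := by simpa using hPn.conj_mem g hgP a⁻¹
    have hcomp : ∀ v, φ a (φ (a⁻¹ * g * a) v) = φ g (φ a v) := by
      intro v
      rw [← hmul, ← hmul]
      simp [mul_assoc]
    have h := congrArg Prod.fst (hcomp o)
    rw [hrot] at h
    rcases fst_map_rotation_or_reflection hn (φ a) with ⟨c, hc⟩ | ⟨c, hc⟩
    · left
      rw [hc, hc] at h
      refine hinjP _ hq _ hgP ?_
      rw [hrot]
      linear_combination h
    · right
      rw [hc, hc] at h
      refine hinjP _ hq _ (P.inv_mem hgP) ?_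
      rw [hrotinv]
      linear_combination -h
  have hadj : ∀ v, (Q n).Adj v (φ g v) ↔ g ∈ S := by
    intro v
    rw [hφ, adj_leftTranslation_iff]
    rcases hconj (e v) with h | h <;> rw [h]
    exact ⟨fun h => by simpa using hS _ h, hS g⟩
  obtain ⟨⟨v, hv⟩, w, hw⟩ := exists_adj_and_exists_not_adj hn (φ g) hrot
  exact hw ((hadj w).2 ((hadj v).1 hv))

end CISGraphs

theorem mainTheorem5 (n : ℕ) (hn : 4 ≤ n) :
    (CISGraphs.Q n).Connected ∧
    CISGraphs.IsVertexTransitive (CISGraphs.Q n) ∧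
    CISGraphs.IsCIS (CISGraphs.Q n) ∧
    Nat.card (ZMod n × ZMod 2 × ZMod 2) = 4 * n ∧
    CISGraphs.HasValency (CISGraphs.Q n) 7 ∧
    (CISGraphs.Q n).indepNum = n ∧
    (CISGraphs.Q n).cliqueNum = 4 ∧
    (n.Prime → ¬ CISGraphs.IsCayley (CISGraphs.Q n)) := by
  have : NeZero n := ⟨by omega⟩
  exact ⟨CISGraphs.connected_Q hn, CISGraphs.isVertexTransitive_Q hn, CISGraphs.isCIS_Q hn,
    by simp [Nat.card_eq_fintype_card, ZMod.card, mul_comm], CISGraphs.hasValency_Q hn,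
    CISGraphs.indepNum_Q hn, CISGraphs.cliqueNum_Q hn, CISGraphs.not_isCayley_Q hn⟩
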